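/- Let $\Psi=\{f_1,\dots,f_N\}$, $N\ge 2$, be a system of contracting similitudes on $\mathbb{R}^n$ with similarity ratios $r_1,\dots,r_N\in(0,1)$, and let $E\subset\mathbb{R}^n$ be its self-similar set, i.e. the nonempty compact set with $E=\bigcup_{i=1}^N f_i(E)$. Assume the strong separation condition (SSC): $f_i(E)\cap f_j(E)=\emptyset$ for all $i\ne j$. Put $r_{\min}=\min_i r_i$ and $$c=\min_{i\neq j}\ \inf\{|x-y| : x\in f_i(E),\ y\in f_j(E)\},$$ let $s$ be the similarity dimension, i.e. the solution of $\sum_{i=1}^N r_i^s=1$, and let $\mu$ be the natural probability measure on $E$, i.e. the Borel probability measure with $\mu(f_{i_1}\circ\cdots\circ f_{i_k}(E))=(r_{i_1}\cdots r_{i_k})^s$ for all $k$ and all $i_1,\dots,i_k\in\{1,\dots,N\}$. Let $B(x,d)$ be the closed Euclidean ball with centre $x$ and radius $d$, put $$h(x,d)=\frac{(2d)^s}{\mu(B(x,d))}\qquad(x\in E,\ d>0),$$ and let $P^s$ be the $s$-dimensional packing measure, $P^s(A)=\inf\{\sum_{i=1}^\infty P^s_0(U_i): A\subset\bigcup_{i=1}^\infty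 U_i\}$, where $P_0^s(A)=\lim_{\delta\to0}P^s_\delta(A)$ and $P^s_\delta(A)$ is the supremum of $\sum_i|B_i|^s$ over all countable collections of pairwise disjoint closed balls $B_i$ centred at points of $A$ with diameters $|B_i|\le\delta$. Then for every $a\in(0,c/r_{\min}]$ there is a pair $(x_0,d_0)\in E\times[a\,r_{\min},a)$ such that $$P^s(E)=h(x_0,d_0)\qquad\text{and}\qquad \partial B(x_0,d_0)\cap E\ne\emptyset .$$ In particular $d_0=|x_0-y|$ for some $y\in E$, so that the optimal radius $d_0$ is a distance between two points of $E$. -/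

import Mathlib

open MeasureTheory Set
open scoped ENNReal

noncomputable section

/-! ### Packing measures in a metric space -/

section Packing

variable {X : Type*} [PseudoMetricSpace X]

/-- `T` is a `δ`-packing of `A`: a countable collection of pairwise disjoint closed balls
(encoded by the pairs (centre, radius), with positive radii), centred at points of `A` and
of diameter at most `δ`. -/
def IsPacking (A : Set X) (δ : ℝ) (T : Set (X × ℝ)) : Prop :=
  T.Countable ∧
  (∀ p ∈ T, p.1 ∈ A ∧ 0 < p.2 ∧ Metric.diam (Metric.closedBall p.1 p.2) ≤ δ) ∧
  T.PairwiseDisjoint (fun p => Metric.closedBall p.1 p.2)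

/-- `P_δ^s(A)`: the supremum over all `δ`-packings of `A` of the sum of the `s`-th powers of the
diameters of the balls. -/
def packingDelta (s δ : ℝ) (A : Set X) : ℝ≥0∞ :=
  ⨆ (T : Set (X × ℝ)) (_ : IsPacking A δ T),
    ∑' p : T, ENNReal.ofReal (Metric.diam (Metric.closedBall p.1.1 p.1.2) ^ s)

/-- The packing premeasure `P_0^s(A)`. As `P_δ^s(A)` is nondecreasing in `δ`, its limit as
`δ → 0+` is its infimum over `δ > 0`. -/
def packingPremeasure (s : ℝ) (A : Set X) : ℝ≥0∞ :=
  ⨅ (δ : ℝ) (_ : 0 < δ), packingDelta s δ A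

/-- The `s`-dimensional packing measure `P^s(A)`. -/
def packingMeasure (s : ℝ) (A : Set X) : ℝ≥0∞ :=
  ⨅ (U : ℕ → Set X) (_ : A ⊆ ⋃ i, U i), ∑' i, packingPremeasure s (U i)

end Packing

/-! ### Systems of contracting similitudes and their self-similar sets -/

/-- A system of `N` contracting similitudes on `ℝⁿ`. -/
structure SimilitudeSystem (n N : ℕ) where
  /-- the similitudes `f_i` -/
  map : Fin N → EuclideanSpace ℝ (Fin n) → EuclideanSpace ℝ (Fin n)
  /-- the similarity ratios `r_i` -/
  ratio : Fin N → ℝ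
  ratio_pos : ∀ i, 0 < ratio i
  ratio_lt_one : ∀ i, ratio i < 1
  dist_map : ∀ i x y, dist (map i x) (map i y) = ratio i * dist x y

namespace SimilitudeSystem

variable {n N : ℕ} (Ψ : SimilitudeSystem n N)

/-- `E` is a self-similar set of the system: nonempty, compact and `E = ⋃ i, f_i(E)`. -/
def IsSelfSimilarSet (E : Set (EuclideanSpace ℝ (Fin n))) : Prop :=
  E.Nonempty ∧ IsCompact E ∧ E = ⋃ i, Ψ.map i '' E

/-- The strong separation condition (SSC). -/
def StrongSeparation (E : Set (EuclideanSpace ℝ (Fin n))) : Prop :=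
  ∀ i j, i ≠ j → Disjoint (Ψ.map i '' E) (Ψ.map j '' E)

/-- `s` is the similarity dimension: `∑ r_i ^ s = 1` (this determines `s`). -/
def IsSimilarityDimension (s : ℝ) : Prop :=
  ∑ i, Ψ.ratio i ^ s = 1

/-- `r_min`, the smallest similarity ratio. -/
def rMin : ℝ := ⨅ i, Ψ.ratio i

/-- `c`, the minimum over `i ≠ j` of the distance `inf {dist x y : x ∈ f_i(E), y ∈ f_j(E)}`. -/
def gap (E : Set (EuclideanSpace ℝ (Fin n))) : ℝ :=
  ⨅ p : {p : Fin N × Fin N // p.1 ≠ p.2},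
    sInf (Set.image2 dist (Ψ.map p.1.1 '' E) (Ψ.map p.1.2 '' E))

/-- `f_{i(k)} = f_{i_1} ∘ ⋯ ∘ f_{i_k}` for an infinite code `w = (i_1, i_2, …)`
(which is indexed from `0` here). -/
def codeMap (w : ℕ → Fin N) : ℕ → EuclideanSpace ℝ (Fin n) → EuclideanSpace ℝ (Fin n)
  | 0 => id
  | k + 1 => codeMap w k ∘ Ψ.map (w k)

/-- The projection of a code `w`: the point of `⋂ k, f_{w(k)}(E)`. -/
def codeProjection (E : Set (EuclideanSpace ℝ (Fin n))) (w : ℕ → Fin N) :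
    EuclideanSpace ℝ (Fin n) :=
  Classical.epsilon (fun x => x ∈ ⋂ k, Ψ.codeMap w k '' E)

/-- The weights `r_i ^ s` as a measure on the alphabet. -/
def letterMeasure (s : ℝ) : Measure (Fin N) :=
  ∑ i, ENNReal.ofReal (Ψ.ratio i ^ s) • Measure.dirac i

/-- The natural probability measure `μ` on `E`: the image under the projection of the product
measure on the code space whose cylinders have mass `(r_{i_1} ⋯ r_{i_k}) ^ s`.
By `naturalMeasure_cylinder` below, it is the measure with `μ(E_i) = r_i ^ s` on cylinder sets. -/
def naturalMeasure (E : Set (EuclideanSpace ℝ (Fin n))) (s : ℝ) :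
    Measure (EuclideanSpace ℝ (Fin n)) :=
  (Measure.infinitePi (fun _ : ℕ => Ψ.letterMeasure s)).map (Ψ.codeProjection E)

/-- The density function `h(x, d) = (2d)^s / μ(B(x, d))`. -/
def density (E : Set (EuclideanSpace ℝ (Fin n))) (s : ℝ) (x : EuclideanSpace ℝ (Fin n)) (d : ℝ) :
    ℝ≥0∞ :=
  ENNReal.ofReal ((2 * d) ^ s) / Ψ.naturalMeasure E s (Metric.closedBall x d)

/-! The natural measure has the mass `r_i ^ s` on every cylinder set. -/

variable {Ψ} {E : Set (EuclideanSpace ℝ (Fin n))}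

theorem dist_codeMap (w : ℕ → Fin N) (k : ℕ) (x y : EuclideanSpace ℝ (Fin n)) :
    dist (Ψ.codeMap w k x) (Ψ.codeMap w k y)
      = (∏ j ∈ Finset.range k, Ψ.ratio (w j)) * dist x y := by
  induction k generalizing x y with
  | zero => simp [codeMap]
  | succ k ih =>
    simp only [codeMap, Function.comp_apply, ih, Ψ.dist_map, Finset.prod_range_succ]
    ring

theorem codeMap_injective (w : ℕ → Fin N) (k : ℕ) : Function.Injective (Ψ.codeMap w k) := by
  intro x y h
  have h1 := dist_codeMap (Ψ := Ψ) w k x y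
  rw [h, dist_self] at h1
  have h2 : (0 : ℝ) < ∏ j ∈ Finset.range k, Ψ.ratio (w j) :=
    Finset.prod_pos fun j _ => Ψ.ratio_pos _
  exact dist_eq_zero.1 ((mul_eq_zero.1 h1.symm).resolve_left h2.ne')

theorem continuous_codeMap (w : ℕ → Fin N) (k : ℕ) : Continuous (Ψ.codeMap w k) := by
  have : LipschitzWith (∏ j ∈ Finset.range k, Ψ.ratio (w j)).toNNReal (Ψ.codeMap w k) := by
    refine LipschitzWith.of_dist_le_mul fun x y => ?_
    rw [dist_codeMap, Real.coe_toNNReal _ (Finset.prod_nonneg fun j _ => (Ψ.ratio_pos _).le)]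
  exact this.continuous

theorem codeMap_congr {v w : ℕ → Fin N} {k : ℕ} (h : ∀ j < k, v j = w j) :
    Ψ.codeMap v k = Ψ.codeMap w k := by
  induction k with
  | zero => rfl
  | succ k ih =>
    simp only [codeMap]
    rw [ih fun j hj => h j (by omega), h k (by omega)]

theorem codeMap_succ_subset (hE : Ψ.IsSelfSimilarSet E) (w : ℕ → Fin N) (k : ℕ) :
    Ψ.codeMap w (k + 1) '' E ⊆ Ψ.codeMap w k '' E := by
  rw [codeMap, Set.image_comp]
  refine Set.image_mono ?_
  conv_rhs => rw [hE.2.2]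
  exact Set.subset_iUnion (fun i => Ψ.map i '' E) (w k)

theorem codeProjection_mem (hE : Ψ.IsSelfSimilarSet E) (w : ℕ → Fin N) (k : ℕ) :
    Ψ.codeProjection E w ∈ Ψ.codeMap w k '' E := by
  have hc : ∀ k, IsCompact (Ψ.codeMap w k '' E) := fun k =>
    hE.2.1.image (continuous_codeMap w k)
  have hne := IsCompact.nonempty_iInter_of_sequence_nonempty_isCompact_isClosed
    (fun k => Ψ.codeMap w k '' E) (codeMap_succ_subset hE w)
    (fun k => hE.1.image _) (hc 0) (fun k => (hc k).isClosed)
  exact Set.mem_iInter.1 (Classical.epsilon_spec hne) k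

theorem eq_of_mem_codeMap (hE : Ψ.IsSelfSimilarSet E) (hS : Ψ.StrongSeparation E)
    (v w : ℕ → Fin N) (k : ℕ) (x : EuclideanSpace ℝ (Fin n))
    (hv : x ∈ Ψ.codeMap v k '' E) (hw : x ∈ Ψ.codeMap w k '' E) :
    ∀ j < k, v j = w j := by
  induction k with
  | zero => intro j hj; omega
  | succ k ih =>
    have h := ih (codeMap_succ_subset hE v k hv) (codeMap_succ_subset hE w k hw)
    intro j hj
    rcases Nat.lt_succ_iff_lt_or_eq.1 hj with hj | rfl
    · exact h j hj
    · by_contra hne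
      obtain ⟨y, hy, rfl⟩ := hv
      obtain ⟨z, hz, hzy⟩ := hw
      simp only [codeMap, Function.comp_apply, codeMap_congr h] at hzy
      have h3 := codeMap_injective w j hzy
      exact Set.disjoint_left.1 (hS _ _ hne) ⟨y, hy, rfl⟩ ⟨z, hz, h3⟩

theorem continuous_codeProjection (hE : Ψ.IsSelfSimilarSet E) :
    Continuous (Ψ.codeProjection E) := by
  obtain ⟨C, hC⟩ := hE.2.1.isBounded.exists_norm_le
  rw [continuous_iff_continuousAt]
  intro w
  have : Nonempty (Fin N) := ⟨w 0⟩
  obtain ⟨i₀, hi₀⟩ := Finite.exists_max Ψ.ratio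
  rw [Metric.continuousAt_iff']
  intro ε hε
  have hlim : Filter.Tendsto (fun k => Ψ.ratio i₀ ^ k * (C + C)) Filter.atTop (nhds 0) := by
    simpa using (tendsto_pow_atTop_nhds_zero_of_lt_one (Ψ.ratio_pos i₀).le
      (Ψ.ratio_lt_one i₀)).mul_const (C + C)
  obtain ⟨k, hk⟩ := (hlim.eventually (gt_mem_nhds hε)).exists
  have hev : ∀ᶠ v in nhds w, ∀ j ∈ Finset.range k, v j = w j := by
    rw [Filter.eventually_all_finset]
    intro j _
    have hj : Filter.Tendsto (fun v : ℕ → Fin N => v j) (nhds w) (nhds (w j)) :=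
      (continuous_apply j).continuousAt
    rw [nhds_discrete (Fin N), Filter.tendsto_pure] at hj
    exact hj
  filter_upwards [hev] with v hv
  have hv' : ∀ j < k, v j = w j := fun j hj => hv j (Finset.mem_range.2 hj)
  obtain ⟨y, hy, hy'⟩ := codeProjection_mem hE v k
  obtain ⟨z, hz, hz'⟩ := codeProjection_mem hE w k
  rw [← hy', ← hz', codeMap_congr hv', dist_codeMap]
  refine lt_of_le_of_lt ?_ hk
  gcongr
  · exact pow_nonneg (Ψ.ratio_pos i₀).le _
  · calc _ ≤ ∏ j ∈ Finset.range k, Ψ.ratio i₀ :=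
        Finset.prod_le_prod (fun j _ => (Ψ.ratio_pos _).le) (fun j _ => hi₀ _)
      _ = _ := by simp
  · exact (dist_le_norm_add_norm y z).trans (add_le_add (hC y hy) (hC z hz))

theorem letterMeasure_singleton (s : ℝ) (i : Fin N) :
    Ψ.letterMeasure s {i} = ENNReal.ofReal (Ψ.ratio i ^ s) := by
  simp [letterMeasure, Set.indicator_apply, Finset.sum_ite_eq']

theorem isProbabilityMeasure_letterMeasure {s : ℝ} (hs : Ψ.IsSimilarityDimension s) :
    IsProbabilityMeasure (Ψ.letterMeasure s) := by
  refine ⟨?_⟩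
  simp only [letterMeasure, Measure.coe_finsetSum, Finset.sum_apply, Measure.smul_apply,
    measure_univ, smul_eq_mul, mul_one]
  rw [← ENNReal.ofReal_sum_of_nonneg fun i _ => Real.rpow_nonneg (Ψ.ratio_pos i).le s]
  rw [show ∑ i, Ψ.ratio i ^ s = 1 from hs, ENNReal.ofReal_one]

/-- `μ(E_{i(k)}) = r_{i(k)} ^ s` for all cylinder sets. -/
theorem naturalMeasure_cylinder (hE : Ψ.IsSelfSimilarSet E) (hS : Ψ.StrongSeparation E) {s : ℝ}
    (hs : Ψ.IsSimilarityDimension s) (w : ℕ → Fin N) (k : ℕ) :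
    Ψ.naturalMeasure E s (Ψ.codeMap w k '' E)
      = ENNReal.ofReal ((∏ j ∈ Finset.range k, Ψ.ratio (w j)) ^ s) := by
  have := isProbabilityMeasure_letterMeasure hs
  have hpre : Ψ.codeProjection E ⁻¹' (Ψ.codeMap w k '' E)
      = Set.pi (Finset.range k : Set ℕ) (fun j => {w j}) := by
    ext v
    simp only [Set.mem_preimage, Set.mem_pi, Finset.coe_range, Set.mem_Iio, Set.mem_singleton_iff]
    constructor
    · intro h
      exact eq_of_mem_codeMap hE hS v w k _ (codeProjection_mem hE v k) h
    · intro h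
      rw [← codeMap_congr h]
      exact codeProjection_mem hE v k
  rw [naturalMeasure, Measure.map_apply (continuous_codeProjection hE).measurable
    (hE.2.1.image (continuous_codeMap w k)).isClosed.measurableSet, hpre,
    Measure.infinitePi_pi _ (fun j _ => measurableSet_singleton _)]
  simp only [letterMeasure_singleton]
  rw [← Real.finsetProd_rpow _ _ (fun j _ => (Ψ.ratio_pos _).le),
    ENNReal.ofReal_prod_of_nonneg fun j _ => Real.rpow_nonneg (Ψ.ratio_pos _).le s]

end SimilitudeSystem

end

/-! A map `f_i` multiplies both `(2d)^s` and the measure of a ball by `r_i^s`, provided that the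
image ball has radius at most `c`: it then meets the other pieces `f_j(E)` at most in its bounding
sphere, which is null. So `h` is scale invariant (`density_map`), and its supremum over radii `d ≤
a` is a maximum `M` over the compact set `E × [a r_min, a]`. A maximal radius `a` can be traded for
`a r_min`, and a ball of radius below `a` whose boundary misses `E` could be enlarged to increase
`h`; this gives the position of the optimal ball.

It remains to see that `P^s(E) = M`. The balls of a fine packing satisfy `|B|^s ≤ M μ(B)` and are
disjoint, so `P^s(E) ≤ M`. Conversely, if `t < h(x,d)` with `d ≤ c`, a zero-one law shows that
almost every point has arbitrarily small radii with `h > t`. Besicovitch's theorem then packs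
disjoint small balls of this kind around almost all of any set of such points.

Continuity of `h` needs `μ(∂B) = 0`. The functions `α|x|² + ⟨v,x⟩ + β` form a finite-dimensional
space stable under composition with similitudes. Among its subspaces whose common zeros have
positive measure, one of maximal dimension has common zeros of full measure, and a sphere of
positive measure would contain them. This is absurd when its centre lies in `E`. Both this argument
and the zero-one law rest on `naturalMeasure_le_mul_self`. -/

open Metric Filter Topology

namespace SimilitudeSystem

variable {n N : ℕ} {Ψ : SimilitudeSystem n N} {E : Set (EuclideanSpace ℝ (Fin n))} {s : ℝ}

/-! ### Prepending a letter to a code -/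

/-- The code `i w₀ w₁ …`. -/
def consCode (i : Fin N) (w : ℕ → Fin N) : ℕ → Fin N
  | 0 => i
  | k + 1 => w k

theorem measurable_consCode (i : Fin N) : Measurable (consCode i) := by
  refine measurable_pi_lambda _ fun k => ?_
  cases k with
  | zero => exact measurable_const
  | succ k => exact measurable_pi_apply k

theorem codeMap_consCode (i : Fin N) (w : ℕ → Fin N) (k : ℕ) :
    Ψ.codeMap (consCode i w) (k + 1) = Ψ.map i ∘ Ψ.codeMap w k := by
  induction k with
  | zero => rfl
  | succ k ih =>
    rw [codeMap, ih, codeMap, Function.comp_assoc]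
    rfl

theorem exists_ratio_le [NeZero N] (Ψ : SimilitudeSystem n N) :
    ∃ ρ : ℝ, 0 < ρ ∧ ρ < 1 ∧ ∀ i, Ψ.ratio i ≤ ρ := by
  obtain ⟨i₀, hi₀⟩ := Finite.exists_max Ψ.ratio
  exact ⟨_, Ψ.ratio_pos i₀, Ψ.ratio_lt_one i₀, hi₀⟩

theorem eq_of_forall_mem_codeMap (hE : Ψ.IsSelfSimilarSet E) (w : ℕ → Fin N)
    {x y : EuclideanSpace ℝ (Fin n)} (hx : ∀ k, x ∈ Ψ.codeMap w k '' E)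
    (hy : ∀ k, y ∈ Ψ.codeMap w k '' E) : x = y := by
  have : NeZero N := ⟨fun h => by subst h; exact (w 0).elim0⟩
  obtain ⟨ρ, h0, h1, hρ⟩ := Ψ.exists_ratio_le
  have hlim : Tendsto (fun k => ρ ^ k * diam E) atTop (𝓝 0) := by
    simpa using (tendsto_pow_atTop_nhds_zero_of_lt_one h0.le h1).mul_const (diam E)
  refine dist_le_zero.1 (ge_of_tendsto' hlim fun k => ?_)
  obtain ⟨u, hu, rfl⟩ := hx k
  obtain ⟨v, hv, hv'⟩ := hy k
  rw [← hv', dist_codeMap]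
  gcongr
  · calc _ ≤ ∏ j ∈ Finset.range k, ρ :=
        Finset.prod_le_prod (fun j _ => (Ψ.ratio_pos _).le) (fun j _ => hρ _)
      _ = _ := by simp
  · exact dist_le_diam_of_mem hE.2.1.isBounded hu hv

theorem map_image_subset (hE : Ψ.IsSelfSimilarSet E) (i : Fin N) : Ψ.map i '' E ⊆ E := by
  conv_rhs => rw [hE.2.2]
  exact Set.subset_iUnion (fun i => Ψ.map i '' E) i

theorem map_mem (hE : Ψ.IsSelfSimilarSet E) (i : Fin N) {x : EuclideanSpace ℝ (Fin n)}
    (hx : x ∈ E) : Ψ.map i x ∈ E := map_image_subset hE i ⟨x, hx, rfl⟩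

theorem exists_map_eq (hE : Ψ.IsSelfSimilarSet E) {x : EuclideanSpace ℝ (Fin n)}
    (hx : x ∈ E) : ∃ i, ∃ y ∈ E, Ψ.map i y = x := by
  rw [hE.2.2] at hx
  simpa using hx

theorem codeProjection_consCode (hE : Ψ.IsSelfSimilarSet E) (i : Fin N) (w : ℕ → Fin N) :
    Ψ.codeProjection E (consCode i w) = Ψ.map i (Ψ.codeProjection E w) := by
  refine eq_of_forall_mem_codeMap hE (consCode i w) (codeProjection_mem hE _) fun k => ?_
  cases k with
  | zero =>
    simpa [codeMap] using map_mem hE i (by simpa [codeMap] using codeProjection_mem hE w 0)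
  | succ k =>
    rw [codeMap_consCode, image_comp]
    exact mem_image_of_mem _ (codeProjection_mem hE w k)

/-- The first letter is independent of the shifted code, which has the same law. It suffices to
compare the two sides on finite-dimensional boxes. -/
theorem infinitePi_eq_sum_map_consCode (hs : Ψ.IsSimilarityDimension s) :
    Measure.infinitePi (fun _ : ℕ => Ψ.letterMeasure s)
      = ∑ i, ENNReal.ofReal (Ψ.ratio i ^ s) •
        (Measure.infinitePi (fun _ : ℕ => Ψ.letterMeasure s)).map (consCode i) := by
  classical
  have := isProbabilityMeasure_letterMeasure hs
  symm
  refine Measure.eq_infinitePi _ fun I t _ => ?_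
  -- The box is rewritten over an initial segment of indices, with trivial conditions added, so that
  -- the coordinate 0 can be split off.
  obtain ⟨K, hK⟩ : ∃ K, I ⊆ Finset.range (K + 1) :=
    ⟨I.sup id, fun j hj => Finset.mem_range.2 (Nat.lt_succ_of_le (Finset.le_sup (f := id) hj))⟩
  let t' : ℕ → Set (Fin N) := fun j => if j ∈ I then t j else univ
  have hpi : Set.pi (I : Set ℕ) t = Set.pi (Finset.range (K + 1) : Set ℕ) t' := by
    ext w
    simp only [Set.mem_pi, Finset.mem_coe]
    refine ⟨fun h j _ => ?_, fun h j hj => ?_⟩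
    · by_cases hj : j ∈ I
      · simpa [t', hj] using h j hj
      · simp [t', hj]
    · simpa [t', hj] using h j (hK hj)
  have hprod : ∏ j ∈ I, Ψ.letterMeasure s (t j)
      = ∏ j ∈ Finset.range (K + 1), Ψ.letterMeasure s (t' j) := by
    rw [← Finset.prod_subset hK (fun j _ hj => by simp [t', hj])]
    exact Finset.prod_congr rfl fun j hj => by simp [t', hj]
  have hmeas : MeasurableSet (Set.pi (Finset.range (K + 1) : Set ℕ) t') :=
    MeasurableSet.pi (Finset.countable_toSet _) fun _ _ => MeasurableSet.of_discrete
  have hpre : ∀ i, (Measure.infinitePi (fun _ : ℕ => Ψ.letterMeasure s)).map (consCode i)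
      (Set.pi (Finset.range (K + 1) : Set ℕ) t')
      = (t' 0).indicator 1 i * ∏ j ∈ Finset.range K, Ψ.letterMeasure s (t' (j + 1)) := by
    intro i
    rw [Measure.map_apply (measurable_consCode i) hmeas]
    have h : consCode i ⁻¹' Set.pi (Finset.range (K + 1) : Set ℕ) t'
        = {_w | i ∈ t' 0} ∩ Set.pi (Finset.range K : Set ℕ) (fun j => t' (j + 1)) := by
      ext w
      simp only [mem_preimage, Set.mem_pi, Finset.mem_coe, Finset.mem_range, mem_inter_iff,
        mem_ofPred_eq]
      constructor
      · exact fun h => ⟨h 0 (by omega), fun j hj => h (j + 1) (by omega)⟩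
      · rintro ⟨h, h'⟩ (_ | j) hj
        · exact h
        · exact h' j (by omega)
    rw [h, ← Measure.infinitePi_pi _ (fun j _ => MeasurableSet.of_discrete)]
    by_cases hi : i ∈ t' 0 <;> simp [hi]
  rw [hpi, hprod, Finset.prod_range_succ', mul_comm]
  simp only [Measure.coe_finsetSum, Finset.sum_apply, Measure.smul_apply, hpre, smul_eq_mul,
    ← mul_assoc, ← Finset.sum_mul]
  congr 1
  simp [letterMeasure]

/-! ### Self-similarity of the natural measure -/

theorem isProbabilityMeasure_naturalMeasure (hE : Ψ.IsSelfSimilarSet E)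
    (hs : Ψ.IsSimilarityDimension s) : IsProbabilityMeasure (Ψ.naturalMeasure E s) := by
  have := isProbabilityMeasure_letterMeasure hs
  exact Measure.isProbabilityMeasure_map (continuous_codeProjection hE).measurable.aemeasurable

theorem continuous_map (i : Fin N) : Continuous (Ψ.map i) :=
  (LipschitzWith.of_dist_le_mul (K := (Ψ.ratio i).toNNReal) fun x y => by
    rw [Ψ.dist_map, Real.coe_toNNReal _ (Ψ.ratio_pos i).le]).continuous

theorem naturalMeasure_eq_sum (hE : Ψ.IsSelfSimilarSet E) (hs : Ψ.IsSimilarityDimension s)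
    {A : Set (EuclideanSpace ℝ (Fin n))} (hA : MeasurableSet A) :
    Ψ.naturalMeasure E s A
      = ∑ i, ENNReal.ofReal (Ψ.ratio i ^ s) * Ψ.naturalMeasure E s (Ψ.map i ⁻¹' A) := by
  have hπ := (continuous_codeProjection hE).measurable
  rw [naturalMeasure, Measure.map_apply hπ hA]
  nth_rw 1 [infinitePi_eq_sum_map_consCode hs]
  simp only [Measure.coe_finsetSum, Finset.sum_apply, Measure.smul_apply, smul_eq_mul]
  refine Finset.sum_congr rfl fun i _ => ?_
  rw [Measure.map_apply (measurable_consCode i) (hπ hA),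
    Measure.map_apply hπ ((continuous_map i).measurable hA)]
  congr 2
  ext w
  simp [codeProjection_consCode hE]

theorem ofReal_ratio_rpow_ne_zero (i : Fin N) : ENNReal.ofReal (Ψ.ratio i ^ s) ≠ 0 := by
  simpa using Real.rpow_pos_of_pos (Ψ.ratio_pos i) s

theorem naturalMeasure_compl (hE : Ψ.IsSelfSimilarSet E) :
    Ψ.naturalMeasure E s Eᶜ = 0 := by
  rw [naturalMeasure, Measure.map_apply (continuous_codeProjection hE).measurable
    hE.2.1.isClosed.measurableSet.compl]
  have : Ψ.codeProjection E ⁻¹' Eᶜ = ∅ := by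
    ext w
    simpa [codeMap] using codeProjection_mem hE w 0
  rw [this, measure_empty]

theorem naturalMeasure_congr (hE : Ψ.IsSelfSimilarSet E) {A B : Set (EuclideanSpace ℝ (Fin n))}
    (h : ∀ x ∈ E, x ∈ A ↔ x ∈ B) : Ψ.naturalMeasure E s A = Ψ.naturalMeasure E s B := by
  refine measure_congr ?_
  have : ∀ᵐ x ∂Ψ.naturalMeasure E s, x ∈ E := naturalMeasure_compl hE
  filter_upwards [this] with x hx using propext (h x hx)

theorem naturalMeasure_self (hE : Ψ.IsSelfSimilarSet E) (hs : Ψ.IsSimilarityDimension s) :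
    Ψ.naturalMeasure E s E = 1 := by
  have := isProbabilityMeasure_naturalMeasure hE hs
  exact (prob_compl_eq_zero_iff hE.2.1.isClosed.measurableSet).1 (naturalMeasure_compl hE)

theorem naturalMeasure_eq_zero (hE : Ψ.IsSelfSimilarSet E) {A : Set (EuclideanSpace ℝ (Fin n))}
    (h : ∀ x ∈ E, x ∉ A) : Ψ.naturalMeasure E s A = 0 := by
  rw [naturalMeasure_congr (B := ∅) hE (by simpa using h), measure_empty]

/-- By self-similarity, a ball about `f_i(y)` has at least `r_i^s` times the measure of a ball about
`y` whose radius is larger by the factor `1/ρ`. Iteration reaches a ball that contains `E`. -/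
theorem naturalMeasure_ball_pos (hE : Ψ.IsSelfSimilarSet E) (hs : Ψ.IsSimilarityDimension s)
    {x : EuclideanSpace ℝ (Fin n)} (hx : x ∈ E) {ε : ℝ} (hε : 0 < ε) :
    0 < Ψ.naturalMeasure E s (ball x ε) := by
  have : NeZero N := ⟨fun h => by
    subst h
    obtain ⟨i, -⟩ := exists_map_eq hE hx
    exact i.elim0⟩
  obtain ⟨ρ, h0, h1, hρ⟩ := Ψ.exists_ratio_le
  have key : ∀ k : ℕ, ∀ x ∈ E, 0 < Ψ.naturalMeasure E s (ball x (ρ ^ k * (diam E + 1))) := by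
    intro k
    induction k with
    | zero =>
      intro x hx
      have : E ⊆ ball x (ρ ^ 0 * (diam E + 1)) := fun y hy => by
        have := dist_le_diam_of_mem hE.2.1.isBounded hy hx
        rw [mem_ball, pow_zero, one_mul]
        linarith
      exact (by simp [naturalMeasure_self hE hs] : 0 < Ψ.naturalMeasure E s E).trans_le
        (measure_mono this)
    | succ k ih =>
      intro x hx
      obtain ⟨i, y, hy, rfl⟩ := exists_map_eq hE hx
      have hsub : ball y (ρ ^ k * (diam E + 1))
          ⊆ Ψ.map i ⁻¹' ball (Ψ.map i y) (ρ ^ (k + 1) * (diam E + 1)) := fun z hz => by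
        rw [mem_preimage, mem_ball, Ψ.dist_map]
        calc _ < Ψ.ratio i * (ρ ^ k * (diam E + 1)) := by
              gcongr
              · exact Ψ.ratio_pos i
              · exact hz
          _ ≤ ρ * (ρ ^ k * (diam E + 1)) := by
              gcongr
              · exact hρ i
          _ = _ := by ring
      rw [naturalMeasure_eq_sum hE hs measurableSet_ball]
      refine (ENNReal.mul_pos (ofReal_ratio_rpow_ne_zero (Ψ := Ψ) (s := s) i)
        ((ih y hy).trans_le (measure_mono hsub)).ne').trans_le ?_
      exact Finset.single_le_sum (f := fun i => ENNReal.ofReal (Ψ.ratio i ^ s) *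
        Ψ.naturalMeasure E s (Ψ.map i ⁻¹' _)) (fun _ _ => zero_le) (Finset.mem_univ i)
  have hlim : Tendsto (fun k => ρ ^ k * (diam E + 1)) atTop (𝓝 0) := by
    simpa using (tendsto_pow_atTop_nhds_zero_of_lt_one h0.le h1).mul_const (diam E + 1)
  obtain ⟨k, hk⟩ := (hlim.eventually (gt_mem_nhds hε)).exists
  exact (key k x hx).trans_le (measure_mono (ball_subset_ball hk.le))

/-- If a class of closed sets is stable under the preimages by the similitudes, and the natural
measure `μ` is at most `M` on the class, then `μ(D) ≤ M μ(D)` for all `D` in the class. -/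
theorem naturalMeasure_le_mul_self (hE : Ψ.IsSelfSimilarSet E) (hs : Ψ.IsSimilarityDimension s)
    {C : Set (Set (EuclideanSpace ℝ (Fin n)))} {M : ℝ≥0∞}
    (hclosed : ∀ D ∈ C, IsClosed D) (hpre : ∀ D ∈ C, ∀ i, Ψ.map i ⁻¹' D ∈ C)
    (hM : ∀ D ∈ C, Ψ.naturalMeasure E s D ≤ M) {D : Set (EuclideanSpace ℝ (Fin n))}
    (hD : D ∈ C) : Ψ.naturalMeasure E s D ≤ M * Ψ.naturalMeasure E s D := by
  have := isProbabilityMeasure_naturalMeasure hE hs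
  have : NeZero N := ⟨fun h => by
    subst h
    obtain ⟨i, -⟩ := exists_map_eq hE hE.1.some_mem
    exact i.elim0⟩
  obtain ⟨ρ, h0, h1, hρ⟩ := Ψ.exists_ratio_le
  -- A localised form: at generation `k`, each piece of `E` that meets `K` lies in the thickening of
  -- `K` and carries at most the fraction `M` of its mass in `D`. The choice `K = D` and `k → ∞`
  -- give the claim.
  have key : ∀ k : ℕ, ∀ D ∈ C, ∀ K : Set (EuclideanSpace ℝ (Fin n)), IsClosed K →
      Ψ.naturalMeasure E s (D ∩ K)
        ≤ M * Ψ.naturalMeasure E s (cthickening (ρ ^ k * diam E) K) := by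
    intro k
    induction k with
    | zero =>
      intro D hD K hK
      by_cases h : (E ∩ K).Nonempty
      · obtain ⟨z, hz, hzK⟩ := h
        have : E ⊆ cthickening (ρ ^ 0 * diam E) K := fun y hy =>
          mem_cthickening_of_dist_le y z _ _ hzK
            (by simpa using dist_le_diam_of_mem hE.2.1.isBounded hy hz)
        have h1 : 1 ≤ Ψ.naturalMeasure E s (cthickening (ρ ^ 0 * diam E) K) :=
          (naturalMeasure_self hE hs).ge.trans (measure_mono this)
        calc _ ≤ Ψ.naturalMeasure E s D := measure_mono inter_subset_left
          _ ≤ M * 1 := by simpa using hM D hD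
          _ ≤ _ := by gcongr
      · rw [naturalMeasure_eq_zero hE fun x hx hxK => h ⟨x, hx, hxK.2⟩]
        exact zero_le
    | succ k ih =>
      intro D hD K hK
      rw [naturalMeasure_eq_sum hE hs ((hclosed D hD).inter hK).measurableSet,
        naturalMeasure_eq_sum hE hs isClosed_cthickening.measurableSet, Finset.mul_sum]
      refine Finset.sum_le_sum fun i _ => ?_
      rw [mul_left_comm]
      gcongr
      rw [preimage_inter]
      refine (ih _ (hpre D hD i) _ (hK.preimage (continuous_map i))).trans ?_
      gcongr
      intro x hx
      rw [(hK.preimage (continuous_map i)).cthickening_eq_biUnion_closedBall (by positivity)] at hx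
      simp only [mem_iUnion, mem_closedBall, exists_prop] at hx
      obtain ⟨z, hz, hxz⟩ := hx
      refine mem_cthickening_of_dist_le _ (Ψ.map i z) _ _ hz ?_
      rw [Ψ.dist_map, pow_succ', mul_assoc]
      gcongr
      exact hρ i
  have hlim : Tendsto (fun k => ρ ^ k * diam E) atTop (𝓝 0) := by
    simpa using (tendsto_pow_atTop_nhds_zero_of_lt_one h0.le h1).mul_const (diam E)
  have hlim' := (tendsto_measure_cthickening_of_isClosed
    (μ := Ψ.naturalMeasure E s) ⟨1, one_pos, measure_ne_top _ _⟩ (hclosed D hD)).comp hlim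
  by_cases hMtop : M = ∞
  · by_cases h : Ψ.naturalMeasure E s D = 0
    · simp [h]
    · simp [hMtop, ENNReal.top_mul h]
  refine ge_of_tendsto' (ENNReal.Tendsto.const_mul hlim' (Or.inr hMtop)) fun k => ?_
  simpa using key k D hD D (hclosed D hD)

end SimilitudeSystem

/-! ### Zero sets of spaces of quadratic functions -/

section ZeroLocus

variable {X : Type*}

/-- The common zeros of a space of functions. -/
def commonZeros (L : Submodule ℝ (X → ℝ)) : Set X := {x | ∀ f ∈ L, f x = 0}

theorem commonZeros_sup (L L' : Submodule ℝ (X → ℝ)) :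
    commonZeros (L ⊔ L') = commonZeros L ∩ commonZeros L' := by
  ext x
  constructor
  · exact fun h => ⟨fun f hf => h f (Submodule.mem_sup_left hf),
      fun f hf => h f (Submodule.mem_sup_right hf)⟩
  · rintro ⟨h, h'⟩ f hf
    obtain ⟨g, hg, g', hg', rfl⟩ := Submodule.mem_sup.1 hf
    simp [h g hg, h' g' hg']

theorem commonZeros_span_singleton (f : X → ℝ) :
    commonZeros (Submodule.span ℝ {f}) = {x | f x = 0} := by
  ext x
  constructor
  · exact fun h => h f (Submodule.mem_span_singleton_self f)
  · intro h g hg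
    obtain ⟨c, rfl⟩ := Submodule.mem_span_singleton.1 hg
    simp [show f x = 0 from h]

theorem commonZeros_map_funLeft (g : X → X) (L : Submodule ℝ (X → ℝ)) :
    commonZeros (L.map (LinearMap.funLeft ℝ ℝ g)) = g ⁻¹' commonZeros L := by
  ext x
  simp [commonZeros, LinearMap.funLeft_apply]

/-- The functions spanned by the constants and the squared distances to points. -/
def sphericalFunctions (X : Type*) [PseudoMetricSpace X] : Submodule ℝ (X → ℝ) :=
  Submodule.span ℝ ({fun _ => 1} ∪ range fun p x => dist x p ^ 2)

theorem isClosed_commonZeros [PseudoMetricSpace X] {L : Submodule ℝ (X → ℝ)}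
    (hL : L ≤ sphericalFunctions X) : IsClosed (commonZeros L) := by
  have hcont : ∀ f ∈ sphericalFunctions X, Continuous f := by
    intro f hf
    refine Submodule.span_induction ?_ continuous_const (fun _ _ _ _ hf hg => hf.add hg)
      (fun c _ _ hf => continuous_const.mul hf) hf
    rintro f (rfl | ⟨p, rfl⟩)
    · exact continuous_const
    · fun_prop
  simp only [commonZeros, ofPred_forall]
  exact isClosed_iInter fun f => isClosed_iInter fun hf =>
    isClosed_eq (hcont f (hL hf)) continuous_const

/-- Expanding `|x - p|²` places every generator in the range of a linear map from `ℝ × X × ℝ`. -/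
instance finiteDimensional_sphericalFunctions [NormedAddCommGroup X] [InnerProductSpace ℝ X]
    [FiniteDimensional ℝ X] : FiniteDimensional ℝ (sphericalFunctions X) := by
  let T : (ℝ × X × ℝ) →ₗ[ℝ] (X → ℝ) :=
    { toFun := fun q x => q.1 * ‖x‖ ^ 2 + inner ℝ q.2.1 x + q.2.2
      map_add' := fun q q' => by
        ext x
        simp only [Prod.fst_add, Prod.snd_add, inner_add_left, Pi.add_apply]
        ring
      map_smul' := fun c q => by
        ext x
        simp only [Prod.smul_fst, Prod.smul_snd, real_inner_smul_left, smul_eq_mul, Pi.smul_apply,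
          RingHom.id_apply]
        ring }
  refine Submodule.finiteDimensional_of_le (S₂ := LinearMap.range T) (Submodule.span_le.2 ?_)
  rintro f (rfl | ⟨p, rfl⟩)
  · exact ⟨(0, 0, 1), by ext x; simp [T]⟩
  · refine ⟨(1, (-2 : ℝ) • p, ‖p‖ ^ 2), ?_⟩
    ext x
    simp only [T, LinearMap.coe_mk, AddHom.coe_mk, real_inner_smul_left, dist_eq_norm,
      norm_sub_sq_real, real_inner_comm x p]
    ring

end ZeroLocus

/-! ### Spheres centred on the self-similar set are null -/

namespace SimilitudeSystem

variable {n N : ℕ} {Ψ : SimilitudeSystem n N} {E : Set (EuclideanSpace ℝ (Fin n))} {s : ℝ}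

/-- Divided by its ratio, the map is an isometry of a strictly convex space, hence affine; its
linear part is injective, so surjective by dimension. Surjectivity makes composition with `f_i`
injective on functions, so that it preserves dimensions of subspaces. -/
theorem surjective_map (i : Fin N) : Function.Surjective (Ψ.map i) := by
  have hr := (Ψ.ratio_pos i).ne'
  have hiso : Isometry fun x => (Ψ.ratio i)⁻¹ • Ψ.map i x := Isometry.of_dist_eq fun x y => by
    rw [dist_smul₀, Ψ.dist_map, Real.norm_of_nonneg (inv_nonneg.2 (Ψ.ratio_pos i).le),
      inv_mul_cancel_left₀ hr]
  have hsurj : Function.Surjective hiso.affineIsometryOfStrictConvexSpace := by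
    have h := LinearMap.surjective_of_injective
      (f := hiso.affineIsometryOfStrictConvexSpace.linearIsometry.toLinearMap)
      hiso.affineIsometryOfStrictConvexSpace.linearIsometry.injective
    exact (AffineMap.linear_surjective_iff
      hiso.affineIsometryOfStrictConvexSpace.toAffineMap).1 h
  intro y
  obtain ⟨x, hx⟩ := hsurj ((Ψ.ratio i)⁻¹ • y)
  exact ⟨x, smul_right_injective _ (inv_ne_zero hr) hx⟩

theorem map_funLeft_le_sphericalFunctions (i : Fin N)
    {L : Submodule ℝ (EuclideanSpace ℝ (Fin n) → ℝ)} (hL : L ≤ sphericalFunctions _) :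
    L.map (LinearMap.funLeft ℝ ℝ (Ψ.map i)) ≤ sphericalFunctions _ := by
  refine (Submodule.map_mono hL).trans ?_
  rw [sphericalFunctions, Submodule.map_span, Submodule.span_le]
  rintro _ ⟨f, rfl | ⟨p, rfl⟩, rfl⟩
  · exact Submodule.subset_span (Or.inl rfl)
  · obtain ⟨q, rfl⟩ := surjective_map (Ψ := Ψ) i p
    have : LinearMap.funLeft ℝ ℝ (Ψ.map i) (fun x => dist x (Ψ.map i q) ^ 2)
        = Ψ.ratio i ^ 2 • fun x => dist x q ^ 2 := by
      ext x
      simp [LinearMap.funLeft_apply, Ψ.dist_map, mul_pow]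
    simp only [this]
    exact Submodule.smul_mem _ _ (Submodule.subset_span (Or.inr ⟨q, rfl⟩))

/-- There is a single space `L` of functions whose common zeros have full measure and which
contains every spherical function with a zero set of positive measure. -/
theorem exists_submodule_forall_mem (hE : Ψ.IsSelfSimilarSet E)
    (hs : Ψ.IsSimilarityDimension s) :
    ∃ L : Submodule ℝ (EuclideanSpace ℝ (Fin n) → ℝ),
      Ψ.naturalMeasure E s (commonZeros L) = 1 ∧
      ∀ f ∈ sphericalFunctions (EuclideanSpace ℝ (Fin n)),
        Ψ.naturalMeasure E s {x | f x = 0} ≠ 0 → f ∈ L := by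
  classical
  have := isProbabilityMeasure_naturalMeasure hE hs
  set μ := Ψ.naturalMeasure E s with hμ
  set F := sphericalFunctions (EuclideanSpace ℝ (Fin n)) with hF
  let P : ℕ → Prop := fun k => ∃ L ≤ F, Module.finrank ℝ L = k ∧ μ (commonZeros L) ≠ 0
  have hfin : ∀ L ≤ F, FiniteDimensional ℝ L := fun L hL => Submodule.finiteDimensional_of_le hL
  have hP0 : P 0 := ⟨⊥, bot_le, finrank_bot _ _, by
    have : commonZeros (⊥ : Submodule ℝ (EuclideanSpace ℝ (Fin n) → ℝ)) = univ := by
      ext x; simp [commonZeros]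
    simp [this]⟩
  -- The maximal dimension forces two subspaces of this dimension to coincide as soon as their
  -- common zeros overlap in positive measure (`habs`).
  let m := Nat.findGreatest P (Module.finrank ℝ F)
  have hPm : P m := Nat.findGreatest_spec (Nat.zero_le _) hP0
  have hmax : ∀ L ≤ F, μ (commonZeros L) ≠ 0 → Module.finrank ℝ L ≤ m := fun L hL h =>
    Nat.le_findGreatest (Submodule.finrank_mono hL) ⟨L, hL, rfl, h⟩
  have habs : ∀ L ≤ F, Module.finrank ℝ L = m → ∀ L' ≤ F,
      μ (commonZeros L ∩ commonZeros L') ≠ 0 → L' ≤ L := by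
    intro L hL hLm L' hL' h
    rw [← commonZeros_sup] at h
    have := hfin _ (sup_le hL hL')
    have heq := Submodule.eq_of_le_of_finrank_le (le_sup_left : L ≤ L ⊔ L')
      (hLm ▸ hmax _ (sup_le hL hL') h)
    rw [heq]
    exact le_sup_right
  let C : Set (Set (EuclideanSpace ℝ (Fin n))) :=
    {D | ∃ L ≤ F, Module.finrank ℝ L = m ∧ commonZeros L = D}
  have hclosed : ∀ D ∈ C, IsClosed D := by
    rintro _ ⟨L, hL, -, rfl⟩
    exact isClosed_commonZeros hL
  have hpre : ∀ D ∈ C, ∀ i, Ψ.map i ⁻¹' D ∈ C := by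
    rintro _ ⟨L, hL, hLm, rfl⟩ i
    refine ⟨_, map_funLeft_le_sphericalFunctions i hL, ?_, commonZeros_map_funLeft (Ψ.map i) L⟩
    rw [← hLm]
    exact (Submodule.equivMapOfInjective _
      (LinearMap.funLeft_injective_of_surjective ℝ ℝ _ (surjective_map i)) L).finrank_eq.symm
  set M : ℝ≥0∞ := ⨆ D ∈ C, μ D with hMdef
  have hM : ∀ D ∈ C, μ D ≤ M := fun D hD => le_iSup₂ (f := fun D (_ : D ∈ C) => μ D) D hD
  have hM1 : 1 ≤ M := by
    obtain ⟨L, hL, hLm, h⟩ := hPm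
    have := naturalMeasure_le_mul_self hE hs hclosed hpre hM ⟨L, hL, hLm, rfl⟩
    rw [← hμ] at this
    by_contra! hlt
    have h2 := ENNReal.mul_lt_mul_left h (measure_ne_top _ _) hlt
    rw [one_mul] at h2
    exact absurd this (not_le.2 h2)
  -- A zero set of measure above `1/2` realises the supremum: a larger one would overlap it in
  -- positive measure, hence be equal to it.
  have hhalf : (2⁻¹ : ℝ≥0∞) < M := ENNReal.one_half_lt_one.trans_le hM1
  obtain ⟨_, hhalf'⟩ := lt_iSup_iff.1 hhalf
  obtain ⟨⟨L, hL, hLm, rfl⟩, hhD⟩ := lt_iSup_iff.1 hhalf'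
  have hone : μ (commonZeros L) = 1 := by
    refine le_antisymm prob_le_one (not_lt.1 fun hlt => ?_)
    refine absurd hM1 (not_le.2 (lt_of_le_of_lt (iSup₂_le (a := μ (commonZeros L)) ?_) hlt))
    rintro _ ⟨L', hL', hLm', rfl⟩
    by_contra! hlt'
    have hpos : μ (commonZeros L ∩ commonZeros L') ≠ 0 := by
      intro h0
      have hadd := measure_union_add_inter (μ := μ) (commonZeros L)
        (isClosed_commonZeros hL').measurableSet
      rw [h0, add_zero] at hadd
      have h1 : (1 : ℝ≥0∞) < μ (commonZeros L) + μ (commonZeros L') := by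
        rw [← ENNReal.inv_two_add_inv_two]
        exact ENNReal.add_lt_add hhD (hhD.trans hlt')
      exact absurd (hadd ▸ prob_le_one) (not_le.2 h1)
    have := hfin L hL
    have heq : L' = L := Submodule.eq_of_le_of_finrank_le (habs L hL hLm L' hL' hpos)
      (hLm.trans hLm'.symm).le
    exact absurd hlt' (by simp [heq])
  refine ⟨L, hone, fun f hf h => ?_⟩
  -- The zeros of `L` have full measure, so they meet those of `f` in positive measure, and
  -- maximality applies to the line spanned by `f`.
  refine habs L hL hLm _ ((Submodule.span_singleton_le_iff_mem f F).2 hf) ?_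
    (Submodule.mem_span_singleton_self f)
  rw [commonZeros_span_singleton, inter_comm]
  rwa [measure_inter_conull]
  exact (prob_compl_eq_zero_iff (isClosed_commonZeros hL).measurableSet).2 hone

/-- A sphere of positive measure contains the full-measure set of common zeros of `L`. But the open
ball that it bounds has positive measure, since its centre lies in `E`. -/
theorem naturalMeasure_sphere (hE : Ψ.IsSelfSimilarSet E) (hs : Ψ.IsSimilarityDimension s)
    {x : EuclideanSpace ℝ (Fin n)} (hx : x ∈ E) {d : ℝ} (hd : 0 < d) :
    Ψ.naturalMeasure E s (sphere x d) = 0 := by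
  have := isProbabilityMeasure_naturalMeasure hE hs
  by_contra h
  obtain ⟨L, hL, hmem⟩ := exists_submodule_forall_mem hE hs
  let q : EuclideanSpace ℝ (Fin n) → ℝ := (fun y => dist y x ^ 2) - d ^ 2 • fun _ => 1
  have hq : q ∈ sphericalFunctions (EuclideanSpace ℝ (Fin n)) :=
    Submodule.sub_mem _ (Submodule.subset_span (Or.inr ⟨x, rfl⟩))
      (Submodule.smul_mem _ _ (Submodule.subset_span (Or.inl rfl)))
  have hz : {y | q y = 0} = sphere x d := by
    ext y
    simp [q, sub_eq_zero, dist_eq_norm, pow_left_inj₀ (norm_nonneg _) hd.le two_ne_zero]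
  have hsub : commonZeros L ⊆ sphere x d := fun y hy =>
    hz ▸ (hy q (hmem q hq (by rwa [hz])))
  have hone : Ψ.naturalMeasure E s (sphere x d) = 1 :=
    le_antisymm prob_le_one (hL.ge.trans (measure_mono hsub))
  have hzero := (prob_compl_eq_zero_iff isClosed_sphere.measurableSet).2 hone
  refine (naturalMeasure_ball_pos hE hs hx hd).ne' (measure_mono_null (fun y hy => ?_) hzero)
  exact (mem_ball.1 hy).ne

end SimilitudeSystem

namespace SimilitudeSystem

variable {n N : ℕ} {Ψ : SimilitudeSystem n N} {E : Set (EuclideanSpace ℝ (Fin n))} {s : ℝ}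

/-! ### The density function -/

theorem naturalMeasure_closedBall_ne_zero (hE : Ψ.IsSelfSimilarSet E)
    (hs : Ψ.IsSimilarityDimension s) {x : EuclideanSpace ℝ (Fin n)} (hx : x ∈ E) {d : ℝ}
    (hd : 0 < d) : Ψ.naturalMeasure E s (closedBall x d) ≠ 0 :=
  ((naturalMeasure_ball_pos hE hs hx hd).trans_le (measure_mono ball_subset_closedBall)).ne'

/-- Indicators of nearby balls converge off the sphere `∂B(x,d)`, which is null. -/
theorem continuousAt_naturalMeasure_closedBall (hE : Ψ.IsSelfSimilarSet E)
    (hs : Ψ.IsSimilarityDimension s) {x : EuclideanSpace ℝ (Fin n)} (hx : x ∈ E) {d : ℝ}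
    (hd : 0 < d) :
    ContinuousAt (fun p : EuclideanSpace ℝ (Fin n) × ℝ =>
      Ψ.naturalMeasure E s (closedBall p.1 p.2)) (x, d) := by
  have := isProbabilityMeasure_naturalMeasure hE hs
  refine tendsto_measure_of_ae_tendsto_indicator_of_isFiniteMeasure (𝓝 (x, d))
    isClosed_closedBall.measurableSet (fun _ => isClosed_closedBall.measurableSet) ?_
  have hnull : ∀ᵐ y ∂Ψ.naturalMeasure E s, y ∉ sphere x d :=
    measure_eq_zero_iff_ae_notMem.1 (naturalMeasure_sphere hE hs hx hd)
  filter_upwards [hnull] with y hy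
  have hcont : Continuous fun p : EuclideanSpace ℝ (Fin n) × ℝ => dist y p.1 - p.2 := by fun_prop
  rcases lt_or_gt_of_ne (mem_sphere.not.1 hy) with h | h
  · filter_upwards [hcont.continuousAt.eventually (gt_mem_nhds (sub_neg.2 h))] with p hp
    simp only [mem_closedBall]
    exact iff_of_true (sub_neg.1 hp).le h.le
  · filter_upwards [hcont.continuousAt.eventually (lt_mem_nhds (sub_pos.2 h))] with p hp
    simp only [mem_closedBall]
    exact iff_of_false (not_le.2 (sub_pos.1 hp)) (not_le.2 h)

theorem continuousAt_density (hE : Ψ.IsSelfSimilarSet E) (hs : Ψ.IsSimilarityDimension s)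
    {x : EuclideanSpace ℝ (Fin n)} (hx : x ∈ E) {d : ℝ} (hd : 0 < d) :
    ContinuousAt (fun p : EuclideanSpace ℝ (Fin n) × ℝ => Ψ.density E s p.1 p.2) (x, d) := by
  refine ENNReal.Tendsto.div ?_ (Or.inr (naturalMeasure_closedBall_ne_zero hE hs hx hd))
    (continuousAt_naturalMeasure_closedBall hE hs hx hd) (Or.inr ENNReal.ofReal_ne_top)
  refine (ENNReal.continuous_ofReal.tendsto _).comp ?_
  have h : ContinuousAt (fun p : EuclideanSpace ℝ (Fin n) × ℝ => 2 * p.2) (x, d) := by fun_prop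
  exact h.rpow_const (Or.inl (by positivity))

theorem gap_le_dist {i j : Fin N} (hij : i ≠ j) {x y : EuclideanSpace ℝ (Fin n)} (hx : x ∈ E)
    (hy : y ∈ E) : Ψ.gap E ≤ dist (Ψ.map i x) (Ψ.map j y) := by
  refine (ciInf_le (Set.finite_range _).bddBelow
    (⟨(i, j), hij⟩ : {p : Fin N × Fin N // p.1 ≠ p.2})).trans (csInf_le ⟨0, ?_⟩ ?_)
  · rintro _ ⟨_, -, _, -, rfl⟩
    exact dist_nonneg
  · exact ⟨_, ⟨x, hx, rfl⟩, _, ⟨y, hy, rfl⟩, rfl⟩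

theorem naturalMeasure_closedBall_map (hE : Ψ.IsSelfSimilarSet E)
    (hs : Ψ.IsSimilarityDimension s) {x : EuclideanSpace ℝ (Fin n)} (hx : x ∈ E) {d : ℝ}
    (hd : 0 < d) {i : Fin N} (hgap : Ψ.ratio i * d ≤ Ψ.gap E) :
    Ψ.naturalMeasure E s (closedBall (Ψ.map i x) (Ψ.ratio i * d))
      = ENNReal.ofReal (Ψ.ratio i ^ s) * Ψ.naturalMeasure E s (closedBall x d) := by
  have hr := Ψ.ratio_pos i
  rw [naturalMeasure_eq_sum hE hs isClosed_closedBall.measurableSet]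
  rw [Finset.sum_eq_single_of_mem i (Finset.mem_univ i)]
  · congr 2
    ext y
    simp [Ψ.dist_map, hr]
  · intro j _ hji
    -- The radius may equal the gap, so another piece can touch the ball, but only along its null
    -- sphere.
    have hnull := naturalMeasure_sphere hE hs (map_mem hE i hx) (mul_pos hr hd)
    rw [naturalMeasure_eq_sum hE hs isClosed_sphere.measurableSet,
      Finset.sum_eq_zero_iff] at hnull
    rw [← hnull j (Finset.mem_univ j)]
    congr 1
    refine naturalMeasure_congr hE fun y hy => ?_
    simp only [mem_preimage, mem_closedBall, mem_sphere]
    exact ⟨fun h => le_antisymm h (hgap.trans (gap_le_dist hji hy hx)), fun h => h.le⟩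

theorem density_map (hE : Ψ.IsSelfSimilarSet E) (hs : Ψ.IsSimilarityDimension s)
    {x : EuclideanSpace ℝ (Fin n)} (hx : x ∈ E) {d : ℝ} (hd : 0 < d) {i : Fin N}
    (hgap : Ψ.ratio i * d ≤ Ψ.gap E) :
    Ψ.density E s (Ψ.map i x) (Ψ.ratio i * d) = Ψ.density E s x d := by
  have hr := Ψ.ratio_pos i
  rw [density, density, naturalMeasure_closedBall_map hE hs hx hd hgap, mul_left_comm,
    Real.mul_rpow hr.le (by positivity), ENNReal.ofReal_mul (Real.rpow_nonneg hr.le s),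
    ENNReal.mul_div_mul_left _ _ (ofReal_ratio_rpow_ne_zero i) ENNReal.ofReal_ne_top]

/-! ### Densities and the packing measure -/

theorem packingPremeasure_empty {X : Type*} [PseudoMetricSpace X] (s : ℝ) :
    packingPremeasure s (∅ : Set X) = 0 := by
  refine le_antisymm (iInf₂_le_of_le 1 one_pos (iSup₂_le fun T hT => ?_)) zero_le
  have : IsEmpty T := ⟨fun p => (hT.2.1 p p.2).1⟩
  simp

theorem packingMeasure_le_packingDelta {X : Type*} [PseudoMetricSpace X] (s : ℝ) {δ : ℝ}
    (hδ : 0 < δ) (A : Set X) : packingMeasure s A ≤ packingDelta s δ A := by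
  let U : ℕ → Set X := fun k => if k = 0 then A else ∅
  have hU : A ⊆ ⋃ k, U k := fun x hx => mem_iUnion.2 ⟨0, by simpa [U] using hx⟩
  refine (iInf₂_le U hU).trans ?_
  rw [tsum_eq_single 0 fun k hk => by simp [U, hk, packingPremeasure_empty]]
  exact (iInf₂_le δ hδ).trans (by simp [U])

theorem packingDelta_le_of_density_le [Nontrivial (EuclideanSpace ℝ (Fin n))]
    (hE : Ψ.IsSelfSimilarSet E) (hs : Ψ.IsSimilarityDimension s) {δ : ℝ} {M : ℝ≥0∞}
    (hM : ∀ x ∈ E, ∀ d, 0 < d → 2 * d ≤ δ → Ψ.density E s x d ≤ M) :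
    packingDelta s δ E ≤ M := by
  have := isProbabilityMeasure_naturalMeasure hE hs
  refine iSup₂_le fun T hT => ?_
  calc ∑' p : T, ENNReal.ofReal (diam (closedBall p.1.1 p.1.2) ^ s)
      ≤ ∑' p : T, M * Ψ.naturalMeasure E s (closedBall p.1.1 p.1.2) := by
        refine ENNReal.tsum_le_tsum fun p => ?_
        obtain ⟨hc, hr, hd⟩ := hT.2.1 p p.2
        rw [diam_closedBall_eq _ hr.le] at hd ⊢
        rw [← ENNReal.div_le_iff (naturalMeasure_closedBall_ne_zero hE hs hc hr)
          (measure_ne_top _ _)]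
        exact hM _ hc _ hr hd
    _ = M * Ψ.naturalMeasure E s (⋃ p ∈ T, closedBall p.1 p.2) := by
        rw [ENNReal.tsum_mul_left, measure_biUnion hT.1 hT.2.2
          fun p _ => isClosed_closedBall.measurableSet]
    _ ≤ M * 1 := by gcongr; exact prob_le_one
    _ = M := mul_one M

theorem exists_small_density_eq (hE : Ψ.IsSelfSimilarSet E) (hs : Ψ.IsSimilarityDimension s)
    {x : EuclideanSpace ℝ (Fin n)} (hx : x ∈ E) {d : ℝ} (hd : 0 < d) (hgap : d ≤ Ψ.gap E)
    {η : ℝ} (hη : 0 < η) :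
    ∃ y ∈ E, ∃ d' ∈ Ioo 0 η, Ψ.density E s y d' = Ψ.density E s x d := by
  obtain ⟨i, -⟩ := exists_map_eq hE hx
  have hr := Ψ.ratio_pos i
  have hr1 := Ψ.ratio_lt_one i
  have key : ∀ k : ℕ, ∃ y ∈ E, Ψ.density E s y (Ψ.ratio i ^ k * d) = Ψ.density E s x d := by
    intro k
    induction k with
    | zero => exact ⟨x, hx, by simp⟩
    | succ k ih =>
      obtain ⟨y, hy, h⟩ := ih
      refine ⟨Ψ.map i y, map_mem hE i hy, ?_⟩
      rw [pow_succ', mul_assoc, density_map hE hs hy (by positivity), h]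
      rw [← mul_assoc, ← pow_succ']
      exact (mul_le_of_le_one_left hd.le (pow_le_one₀ hr.le hr1.le)).trans hgap
  have hlim : Tendsto (fun k => Ψ.ratio i ^ k * d) atTop (𝓝 0) := by
    simpa using (tendsto_pow_atTop_nhds_zero_of_lt_one hr.le hr1).mul_const d
  obtain ⟨k, hk⟩ := (hlim.eventually (gt_mem_nhds hη)).exists
  obtain ⟨y, hy, h⟩ := key k
  exact ⟨y, hy, _, ⟨by positivity, hk⟩, h⟩

/-- A zero-one law. The exceptional set `D` is closed, and scale invariance of `h` makes the class
of closed sets whose trace on `E` lies in `D` stable under preimages. Hence `μ(D) ≤ μ(D)²`. Some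
small ball has density above `t`, and by continuity so do its neighbours of equal radius, so `μ(D) <
1` and thus `μ(D) = 0`. -/
theorem naturalMeasure_forall_density_le (hE : Ψ.IsSelfSimilarSet E)
    (hs : Ψ.IsSimilarityDimension s) {x : EuclideanSpace ℝ (Fin n)} (hx : x ∈ E) {d : ℝ}
    (hd : 0 < d) (hgap : d ≤ Ψ.gap E) {t : ℝ≥0∞} (ht : t < Ψ.density E s x d) {η : ℝ}
    (hη : 0 < η) (hηgap : η ≤ Ψ.gap E) :
    Ψ.naturalMeasure E s {y | y ∈ E ∧ ∀ d ∈ Ioo 0 η, Ψ.density E s y d ≤ t} = 0 := by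
  have := isProbabilityMeasure_naturalMeasure hE hs
  set D := {y | y ∈ E ∧ ∀ d ∈ Ioo 0 η, Ψ.density E s y d ≤ t} with hDdef
  have hcont : ∀ d, 0 < d → ContinuousOn (fun y => Ψ.density E s y d) E := fun d hd y hy =>
    ((continuousAt_density hE hs hy hd).comp (f := fun y => (y, d))
      (by fun_prop)).continuousWithinAt
  have hclosed : IsClosed D := by
    have : D = ⋂ d ∈ Ioo 0 η, E ∩ (fun y => Ψ.density E s y d) ⁻¹' Iic t := by
      ext y
      simp only [hDdef, mem_ofPred_eq, mem_iInter, mem_inter_iff, mem_preimage, mem_Iic]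
      exact ⟨fun h d hd => ⟨h.1, h.2 d hd⟩,
        fun h => ⟨(h (η / 2) ⟨by positivity, by linarith⟩).1, fun d hd => (h d hd).2⟩⟩
    rw [this]
    exact isClosed_biInter fun d hd =>
      (hcont d hd.1).preimage_isClosed_of_isClosed hE.2.1.isClosed isClosed_Iic
  have hself := naturalMeasure_le_mul_self hE hs (M := Ψ.naturalMeasure E s D)
    (C := {D' | IsClosed D' ∧ D' ∩ E ⊆ D}) (D := D) (fun D' h => h.1) ?_ ?_
    ⟨hclosed, inter_subset_left⟩
  · have hlt : Ψ.naturalMeasure E s D < 1 := by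
      obtain ⟨y, hy, d', hd', h⟩ := exists_small_density_eq hE hs hx hd hgap hη
      rw [← h] at ht
      obtain ⟨ε, hε, hball⟩ := Metric.mem_nhdsWithin_iff.1
        ((hcont d' hd'.1 y hy).eventually (lt_mem_nhds ht))
      refine lt_of_le_of_ne prob_le_one fun hone => ?_
      have hzero := (prob_compl_eq_zero_iff hclosed.measurableSet).2 hone
      refine (naturalMeasure_ball_pos hE hs hy hε).ne' (measure_mono_null (fun z hz => ?_) hzero)
      exact fun hzD => not_lt.2 (hzD.2 d' hd') (hball ⟨hz, hzD.1⟩)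
    by_contra h0
    have h2 := ENNReal.mul_lt_mul_left h0 (measure_ne_top _ _) hlt
    rw [one_mul] at h2
    exact absurd hself (not_le.2 h2)
  · rintro D' ⟨hD', hsub⟩ i
    refine ⟨hD'.preimage (continuous_map i), fun y hy => ⟨hy.2, fun d hd => ?_⟩⟩
    have hr := Ψ.ratio_pos i
    have hlt : Ψ.ratio i * d < η :=
      (mul_le_of_le_one_left hd.1.le (Ψ.ratio_lt_one i).le).trans_lt hd.2
    rw [← density_map hE hs hy.2 hd.1 (hlt.le.trans hηgap)]
    exact (hsub ⟨hy.1, map_mem hE i hy.2⟩).2 _ ⟨mul_pos hr hd.1, hlt⟩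
  · rintro D' ⟨-, hsub⟩
    have : Ψ.naturalMeasure E s D' = Ψ.naturalMeasure E s (D' ∩ E) :=
      naturalMeasure_congr hE fun y hy => by simp [hy]
    rw [this]
    exact measure_mono hsub

theorem ae_exists_small_lt_density (hE : Ψ.IsSelfSimilarSet E)
    (hs : Ψ.IsSimilarityDimension s) {x : EuclideanSpace ℝ (Fin n)} (hx : x ∈ E) {d : ℝ}
    (hd : 0 < d) (hgap : d ≤ Ψ.gap E) {t : ℝ≥0∞} (ht : t < Ψ.density E s x d) :
    ∀ᵐ y ∂Ψ.naturalMeasure E s,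
      y ∈ E ∧ ∀ η > 0, ∃ d ∈ Ioo 0 η, t < Ψ.density E s y d := by
  have hEae : ∀ᵐ y ∂Ψ.naturalMeasure E s, y ∈ E := naturalMeasure_compl hE
  have hgap0 := hd.trans_le hgap
  have hk : ∀ k : ℕ, ∀ᵐ y ∂Ψ.naturalMeasure E s,
      y ∉ {y | y ∈ E ∧ ∀ d ∈ Ioo 0 (min (Ψ.gap E) (1 / ((k : ℝ) + 1))), Ψ.density E s y d ≤ t} :=
    fun k => measure_eq_zero_iff_ae_notMem.1 (naturalMeasure_forall_density_le hE hs hx hd hgap ht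
      (lt_min hgap0 (by positivity)) (min_le_left _ _))
  filter_upwards [hEae, ae_all_iff.2 hk] with y hy hyk
  refine ⟨hy, fun η hη => ?_⟩
  obtain ⟨k, hkη⟩ := exists_nat_one_div_lt hη
  have := hyk k
  simp only [hy, true_and, not_forall, not_le] at this
  obtain ⟨d', hd', h⟩ := this
  exact ⟨d', ⟨hd'.1, (hd'.2.trans_le (min_le_right _ _)).trans hkη⟩, h⟩

/-- Besicovitch's theorem covers almost all of `A` by disjoint balls with `h > t` and radius below
`δ/2`; they form a packing with `t μ(B) ≤ |B|^s`. -/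
theorem le_packingDelta [Nontrivial (EuclideanSpace ℝ (Fin n))]
    (hE : Ψ.IsSelfSimilarSet E) (hs : Ψ.IsSimilarityDimension s)
    {A U : Set (EuclideanSpace ℝ (Fin n))} (hAU : A ⊆ U) (hAE : A ⊆ E) {t : ℝ≥0∞}
    (hA : ∀ y ∈ A, ∀ η > 0, ∃ d ∈ Ioo 0 η, t < Ψ.density E s y d) {δ : ℝ} (hδ : 0 < δ) :
    t * Ψ.naturalMeasure E s A ≤ packingDelta s δ U := by
  have := isProbabilityMeasure_naturalMeasure hE hs
  obtain ⟨T, r, hTc, hTA, hr, hnull, hdisj⟩ := Besicovitch.exists_disjoint_closedBall_covering_ae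
    (Ψ.naturalMeasure E s) (fun y => {d | t < Ψ.density E s y d}) A
    (fun y hy η hη => by
      obtain ⟨d, hd, h⟩ := hA y hy η hη
      exact ⟨d, h, hd⟩)
    (fun _ => δ / 2) (fun _ _ => by positivity)
  have hinj : InjOn (fun y => (y, r y)) T := fun _ _ _ _ h => (Prod.ext_iff.1 h).1
  have hpack : IsPacking U δ ((fun y => (y, r y)) '' T) := by
    refine ⟨hTc.image _, ?_, ?_⟩
    · rintro _ ⟨y, hy, rfl⟩
      obtain ⟨-, h0, h1⟩ := hr y hy
      refine ⟨hAU (hTA hy), h0, ?_⟩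
      rw [diam_closedBall_eq _ h0.le]
      linarith
    · rintro _ ⟨y, hy, rfl⟩ _ ⟨z, hz, rfl⟩ hne
      exact hdisj hy hz fun h => hne (by rw [h])
  refine le_trans ?_ (le_iSup₂ (f := fun T (_ : IsPacking U δ T) =>
    ∑' p : T, ENNReal.ofReal (diam (closedBall p.1.1 p.1.2) ^ s)) _ hpack)
  rw [tsum_image (fun p : EuclideanSpace ℝ (Fin n) × ℝ =>
    ENNReal.ofReal (diam (closedBall p.1 p.2) ^ s)) hinj]
  calc t * Ψ.naturalMeasure E s A
      ≤ t * Ψ.naturalMeasure E s (⋃ y ∈ T, closedBall y (r y)) := by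
        refine mul_le_mul' le_rfl ?_
        refine (measure_le_inter_add_sdiff (Ψ.naturalMeasure E s) A (⋃ y ∈ T, closedBall y (r y))).trans ?_
        rw [hnull, add_zero]
        exact measure_mono inter_subset_right
    _ = ∑' y : T, t * Ψ.naturalMeasure E s (closedBall y (r y)) := by
        rw [ENNReal.tsum_mul_left, measure_biUnion hTc hdisj
          fun p _ => isClosed_closedBall.measurableSet]
    _ ≤ _ := by
        refine ENNReal.tsum_le_tsum fun y => ?_
        obtain ⟨h, h0, -⟩ := hr y y.2
        rw [diam_closedBall_eq _ h0.le]
        exact (ENNReal.le_div_iff_mul_le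
          (Or.inl (naturalMeasure_closedBall_ne_zero hE hs (hAE (hTA y.2)) h0))
          (Or.inl (measure_ne_top _ _))).1 (le_of_lt h)

theorem density_le_packingMeasure [Nontrivial (EuclideanSpace ℝ (Fin n))]
    (hE : Ψ.IsSelfSimilarSet E) (hs : Ψ.IsSimilarityDimension s)
    {x : EuclideanSpace ℝ (Fin n)} (hx : x ∈ E) {d : ℝ} (hd : 0 < d) (hgap : d ≤ Ψ.gap E) :
    Ψ.density E s x d ≤ packingMeasure s E := by
  have := isProbabilityMeasure_naturalMeasure hE hs
  refine le_of_forall_lt_imp_le_of_dense fun t ht => le_iInf₂ fun U hU => ?_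
  set G := {y | y ∈ E ∧ ∀ η > 0, ∃ d ∈ Ioo 0 η, t < Ψ.density E s y d} with hG
  have hGone : 1 ≤ Ψ.naturalMeasure E s G := by
    -- Subadditivity gives `μ(G) ≥ 1` without measurability of `G`.
    have h0 : Ψ.naturalMeasure E s Gᶜ = 0 := ae_exists_small_lt_density hE hs hx hd hgap ht
    have h1 := measure_union_le (μ := Ψ.naturalMeasure E s) G Gᶜ
    rwa [union_compl_self, measure_univ, h0, add_zero] at h1
  calc t = t * 1 := (mul_one t).symm
    _ ≤ t * Ψ.naturalMeasure E s (⋃ k, U k ∩ G) := by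
        gcongr
        refine hGone.trans (measure_mono fun y hy => ?_)
        obtain ⟨k, hk⟩ := mem_iUnion.1 (hU hy.1)
        exact mem_iUnion.2 ⟨k, hk, hy⟩
    _ ≤ t * ∑' k, Ψ.naturalMeasure E s (U k ∩ G) := by
        gcongr
        exact measure_iUnion_le _
    _ = ∑' k, t * Ψ.naturalMeasure E s (U k ∩ G) := ENNReal.tsum_mul_left.symm
    _ ≤ _ := by
        refine ENNReal.tsum_le_tsum fun k => le_iInf₂ fun δ hδ => ?_
        exact le_packingDelta hE hs inter_subset_left (fun y hy => hy.2.1)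
          (fun y hy => hy.2.2) hδ

/-! ### The optimal ball -/

theorem IsSimilarityDimension.pos (hs : Ψ.IsSimilarityDimension s) (hN : 2 ≤ N) : 0 < s := by
  by_contra! h
  have h1 : ∑ _i : Fin N, (1 : ℝ) ≤ ∑ i, Ψ.ratio i ^ s := Finset.sum_le_sum fun i _ =>
    Real.one_le_rpow_of_pos_of_le_one_of_nonpos (Ψ.ratio_pos i) (Ψ.ratio_lt_one i).le h
  rw [show ∑ i, Ψ.ratio i ^ s = 1 from hs] at h1
  simp only [Finset.sum_const, Finset.card_univ, Fintype.card_fin, nsmul_eq_mul, mul_one] at h1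
  have : (2 : ℝ) ≤ N := by exact_mod_cast hN
  linarith

theorem nontrivial_of_strongSeparation (hE : Ψ.IsSelfSimilarSet E)
    (hSSC : Ψ.StrongSeparation E) (hN : 2 ≤ N) : Nontrivial (EuclideanSpace ℝ (Fin n)) := by
  obtain ⟨x, hx⟩ := hE.1
  have hne : (⟨0, by omega⟩ : Fin N) ≠ ⟨1, by omega⟩ := by simp
  exact ⟨_, _, disjoint_iff_forall_ne.1 (hSSC _ _ hne) (mem_image_of_mem _ hx)
    (mem_image_of_mem _ hx)⟩

theorem rMin_le (i : Fin N) : Ψ.rMin ≤ Ψ.ratio i := ciInf_le (Set.finite_range _).bddBelow i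

theorem exists_ratio_eq_rMin [NeZero N] (Ψ : SimilitudeSystem n N) :
    ∃ i, Ψ.ratio i = Ψ.rMin := exists_eq_ciInf_of_finite

/-- A bound for the density function on one fundamental range of radii holds for all
smaller radii. -/
theorem density_le_of_forall_mem_Icc (hE : Ψ.IsSelfSimilarSet E)
    (hs : Ψ.IsSimilarityDimension s) {a : ℝ} (ha : 0 < a) (hr : 0 < Ψ.rMin)
    (hac : a * Ψ.rMin ≤ Ψ.gap E) {M : ℝ≥0∞}
    (hM : ∀ x ∈ E, ∀ d ∈ Icc (a * Ψ.rMin) a, Ψ.density E s x d ≤ M)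
    {x : EuclideanSpace ℝ (Fin n)} (hx : x ∈ E) {d : ℝ} (hd : 0 < d) (hda : d ≤ a) :
    Ψ.density E s x d ≤ M := by
  have : NeZero N := ⟨fun h => by
    subst h
    obtain ⟨i, -⟩ := exists_map_eq hE hx
    exact i.elim0⟩
  obtain ⟨ρ, h0, h1, hρ⟩ := Ψ.exists_ratio_le
  -- A radius `d < a r_min` is replaced by `d / r_i`, which stays at most `a` because `r_min ≤ r_i`
  -- and gains at least the factor `1/ρ`.
  have key : ∀ k : ℕ, ∀ x ∈ E, ∀ d ≤ a, ρ ^ k * (a * Ψ.rMin) ≤ d → Ψ.density E s x d ≤ M := by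
    intro k
    induction k with
    | zero => exact fun x hx d hda hd => hM x hx d ⟨by simpa using hd, hda⟩
    | succ k ih =>
      intro x hx d hda hd
      rcases le_or_gt (a * Ψ.rMin) d with h | h
      · exact hM x hx d ⟨h, hda⟩
      obtain ⟨i, y, hy, rfl⟩ := exists_map_eq hE hx
      have hri := Ψ.ratio_pos i
      have hd0 : 0 < d := lt_of_lt_of_le (by positivity) hd
      have hmul : Ψ.ratio i * (d / Ψ.ratio i) = d := mul_div_cancel₀ d hri.ne'
      have hscale := density_map (i := i) hE hs hy (div_pos hd0 hri)
        (by rw [hmul]; exact h.le.trans hac)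
      rw [hmul] at hscale
      rw [hscale]
      refine ih y hy _ ?_ ?_
      · rw [div_le_iff₀ hri]
        exact h.le.trans (by gcongr; exact rMin_le i)
      · rw [le_div_iff₀ hri]
        refine le_trans ?_ hd
        calc ρ ^ k * (a * Ψ.rMin) * Ψ.ratio i ≤ ρ ^ k * (a * Ψ.rMin) * ρ := by
              gcongr
              exact hρ i
          _ = ρ ^ (k + 1) * (a * Ψ.rMin) := by ring
  have hlim : Tendsto (fun k => ρ ^ k * (a * Ψ.rMin)) atTop (𝓝 0) := by
    simpa using (tendsto_pow_atTop_nhds_zero_of_lt_one h0.le h1).mul_const (a * Ψ.rMin)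
  obtain ⟨k, hk⟩ := (hlim.eventually (gt_mem_nhds hd)).exists
  exact key k x hx d hda hk.le

/-- A ball whose boundary does not meet `E` can be enlarged without changing its measure, which
increases the density function. -/
theorem exists_density_lt (hE : Ψ.IsSelfSimilarSet E) (hs : Ψ.IsSimilarityDimension s)
    (hs0 : 0 < s) {x : EuclideanSpace ℝ (Fin n)} (hx : x ∈ E) {d a : ℝ} (hd : 0 < d)
    (hda : d < a) (hsphere : ¬ (sphere x d ∩ E).Nonempty) :
    ∃ d' ∈ Ioo d a, Ψ.density E s x d < Ψ.density E s x d' := by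
  have := isProbabilityMeasure_naturalMeasure hE hs
  -- `m` is the least distance from `x` to a point of `E` outside the ball; `d + 1` is a default
  -- when there is none.
  obtain ⟨m, hdm, hm⟩ : ∃ m > d, ∀ y ∈ E, d < dist y x → m ≤ dist y x := by
    have hcomp : IsCompact (E ∩ {y | d ≤ dist y x}) :=
      hE.2.1.inter_right (isClosed_le continuous_const (by fun_prop))
    rcases (E ∩ {y | d ≤ dist y x}).eq_empty_or_nonempty with h | h
    · exact ⟨d + 1, by linarith,
        fun y hy hyd => (eq_empty_iff_forall_notMem.1 h y ⟨hy, hyd.le⟩).elim⟩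
    · obtain ⟨z, hz, hmin⟩ := hcomp.exists_isMinOn h (f := fun y => dist y x)
        (by fun_prop)
      refine ⟨dist z x, lt_of_le_of_ne hz.2 fun h => hsphere ⟨z, h.symm, hz.1⟩, ?_⟩
      exact fun y hy hyd => hmin ⟨hy, hyd.le⟩
  obtain ⟨d', hd', hd'm⟩ := exists_between (lt_min hdm hda)
  refine ⟨d', ⟨hd', hd'm.trans_le (min_le_right _ _)⟩, ?_⟩
  have hμ : Ψ.naturalMeasure E s (closedBall x d') = Ψ.naturalMeasure E s (closedBall x d) := by
    refine naturalMeasure_congr hE fun y hy => ⟨fun h => ?_, fun h => h.trans hd'.le⟩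
    by_contra hlt
    have h1 := hm y hy (not_le.1 hlt)
    have h2 := mem_closedBall.1 h
    have h3 := hd'm.trans_le (min_le_left _ _)
    linarith
  rw [density, density, hμ]
  refine (ENNReal.div_lt_div_iff_left (naturalMeasure_closedBall_ne_zero hE hs hx hd)
    (measure_ne_top _ _)).2 ?_
  have hd0 : 0 < d' := hd.trans hd'
  rw [ENNReal.ofReal_lt_ofReal_iff (by positivity)]
  exact Real.rpow_lt_rpow (by positivity) (by linarith) hs0

end SimilitudeSystem

open SimilitudeSystem in
theorem corollary2 {n N : ℕ} (hN : 2 ≤ N) (Ψ : SimilitudeSystem n N)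
    (E : Set (EuclideanSpace ℝ (Fin n))) (hE : Ψ.IsSelfSimilarSet E)
    (hSSC : Ψ.StrongSeparation E) (s : ℝ) (hs : Ψ.IsSimilarityDimension s)
    (a : ℝ) (ha : 0 < a) (hac : a ≤ Ψ.gap E / Ψ.rMin) :
    ∃ x₀ ∈ E, ∃ d₀ ∈ Set.Ico (a * Ψ.rMin) a,
      packingMeasure s E = Ψ.density E s x₀ d₀ ∧
      (frontier (Metric.closedBall x₀ d₀) ∩ E).Nonempty ∧
      ∃ y ∈ E, d₀ = dist x₀ y := by
  have : NeZero N := ⟨by omega⟩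
  have := nontrivial_of_strongSeparation hE hSSC hN
  obtain ⟨i, hi⟩ := Ψ.exists_ratio_eq_rMin
  have hr : 0 < Ψ.rMin := hi ▸ Ψ.ratio_pos i
  have hr1 : Ψ.rMin < 1 := hi ▸ Ψ.ratio_lt_one i
  have har : a * Ψ.rMin < a := mul_lt_of_lt_one_right ha hr1
  have hagap : a * Ψ.rMin ≤ Ψ.gap E := (le_div_iff₀ hr).1 hac
  obtain ⟨x₀, hx₀, d₀, hd₀, hmax⟩ : ∃ x₀ ∈ E, ∃ d₀ ∈ Ico (a * Ψ.rMin) a,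
      ∀ x ∈ E, ∀ d ∈ Icc (a * Ψ.rMin) a, Ψ.density E s x d ≤ Ψ.density E s x₀ d₀ := by
    obtain ⟨⟨x, d⟩, ⟨hx, hd⟩, hmax⟩ := (hE.2.1.prod (isCompact_Icc
      (a := a * Ψ.rMin) (b := a))).exists_isMaxOn
      (hE.1.prod ⟨a, har.le, le_rfl⟩) (f := fun p => Ψ.density E s p.1 p.2)
      (fun p hp => (continuousAt_density hE hs hp.1
        (lt_of_lt_of_le (by positivity) hp.2.1)).continuousWithinAt)
    have hmax' : ∀ y ∈ E, ∀ d' ∈ Icc (a * Ψ.rMin) a, Ψ.density E s y d' ≤ Ψ.density E s x d :=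
      fun y hy d' hd' => hmax (mk_mem_prod hy hd')
    -- A maximum at the excluded endpoint `a` is moved to radius `a r_min` by the map of smallest
    -- ratio.
    rcases hd.2.lt_or_eq with h | h
    · exact ⟨x, hx, d, ⟨hd.1, h⟩, hmax'⟩
    · refine ⟨Ψ.map i x, map_mem hE i hx, a * Ψ.rMin, ⟨le_rfl, har⟩, ?_⟩
      simp only at h
      subst h
      rwa [mul_comm, ← hi, density_map hE hs hx ha (by rwa [hi, mul_comm]), hi, mul_comm]
  have hd₀pos : 0 < d₀ := lt_of_lt_of_le (by positivity) hd₀.1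
  have hsphere : (sphere x₀ d₀ ∩ E).Nonempty := by
    by_contra h
    obtain ⟨d', hd', hlt⟩ := exists_density_lt hE hs (hs.pos hN) hx₀ hd₀pos hd₀.2 h
    exact absurd (hmax x₀ hx₀ d' ⟨hd₀.1.trans hd'.1.le, hd'.2.le⟩) (not_le.2 hlt)
  refine ⟨x₀, hx₀, d₀, hd₀, le_antisymm ?_ ?_, ?_, ?_⟩
  · refine (packingMeasure_le_packingDelta s (δ := 2 * a) (by positivity) E).trans
      (packingDelta_le_of_density_le hE hs fun x hx d hd hda => ?_)
    exact density_le_of_forall_mem_Icc hE hs ha hr hagap hmax hx hd (by linarith)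
  · have hle : Ψ.ratio i * d₀ ≤ Ψ.gap E := by
      refine le_trans ?_ hagap
      rw [hi, mul_comm]
      gcongr
      exact hd₀.2.le
    rw [← density_map hE hs hx₀ hd₀pos hle]
    exact density_le_packingMeasure hE hs (map_mem hE i hx₀)
      (mul_pos (Ψ.ratio_pos i) hd₀pos) hle
  · rwa [frontier_closedBall _ hd₀pos.ne']
  · obtain ⟨y, hy, hyE⟩ := hsphere
    exact ⟨y, hyE, by rw [dist_comm]; exact hy.symm⟩
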